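/- Let $E,A\in\mathbb{C}^{n\times n}$, $B\in\mathbb{C}^{n\times m}$, $C\in\mathbb{C}^{p\times n}$ (in particular, they may be real, and $E$ may be singular). Assume that the pencil $\lambda E-A$ is regular, that all its finite generalized eigenvalues, i.e. the $\lambda\in\mathbb{C}$ with $\det(\lambda E-A)=0$, have negative real part (asymptotic stability), and that the transfer function $G(s)=C(sE-A)^{-1}B$ is strictly proper, i.e. $G(s)\to 0$ as $|s|\to\infty$. Let $S\in\mathbb{C}^{q\times q}$ and $R\in\mathbb{C}^{m\times q}$ be right tangential interpolation data: $S$ has distinct eigenvalues $\sigma_1,\dots,\sigma_q$, none of which is a generalized eigenvalue of $\lambda E-A$, and for a nonsingular $T$ with $TST^{-1}=\operatorname{diag}(\sigma_1,\dots,\sigma_q)$ all columns of $RT^{-1}$ are nonzero. Assume that all eigenvalues of $S$ have positive real part. Let $V\in\mathbb{C}^{n\times q}$ satisfy $AV-EVS-BR=0$ and let $P\in\mathbb{C}^{q\times q}$ satisfy $S^*P+PS-R^*R=0$. Let $\mathcal{H}_2$ be the space of rational functions $F$ with values in $\mathbb{C}^{p\times m}$ that are analytic in the closed right half-plane and satisfy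 $\|F\|_{\mathcal{H}_2}^2=\frac{1}{2\pi}\int_{-\infty}^{\infty}\|F(\mathrm{i}\omega)\|_F^2\,\mathrm{d}\omega<\infty$, where $\|\cdot\|_F$ is the Frobenius norm, and let $$\mathcal{G}(-S^*,R^*)=\{\,C_M(sI_q+S^*)^{-1}R^* : C_M\in\mathbb{C}^{p\times q}\,\}.$$ A function $G_r\in\mathcal{G}(-S^*,R^*)$ is called $\mathcal{H}_2$ pseudo-optimal for $G$ with respect to $\mathcal{G}(-S^*,R^*)$ if $\|G-G_r\|_{\mathcal{H}_2}\le\|G-G_M\|_{\mathcal{H}_2}$ for all $G_M\in\mathcal{G}(-S^*,R^*)$. Then $G\in\mathcal{H}_2$ and $\mathcal{G}(-S^*,R^*)\subset\mathcal{H}_2$, and for the reduced model $$E_r=P,\qquad A_r=-S^*P,\qquad B_r=-R^*,\qquad C_r=CV$$ the following holds: $E_r$ is nonsingular (the reduced model is an ODE model); the reduced model is asymptotically stable, i.e. all generalized eigenvalues of $\lambda E_r-A_r$ have negative real part; and its transfer function $G_r(s)=C_r(sE_r-A_r)^{-1}B_r$ is $\mathcal{H}_2$ pseudo-optimal for $G$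 with respect to $\mathcal{G}(-S^*,R^*)$ and is the only $\mathcal{H}_2$ pseudo-optimal function. -/

import Mathlib

open Matrix Filter Topology MeasureTheory

namespace DAE

variable {n p m q : Type*} [Fintype n] [DecidableEq n] [Fintype p] [Fintype m]
  [Fintype q] [DecidableEq q]

/-- The set of finite generalized eigenvalues of the pencil `λ E - A`. -/
def pencilSpectrum (E A : Matrix n n ℂ) : Set ℂ :=
  {z | (z • E - A).det = 0}

/-- The pencil `λ E - A` is regular: `det (λ E - A) ≠ 0` for some `λ`. -/
def IsRegularPencil (E A : Matrix n n ℂ) : Prop :=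
  ∃ z : ℂ, (z • E - A).det ≠ 0

/-- Asymptotic stability of a system with pencil `λ E - A`: the pencil is regular and all its
finite generalized eigenvalues have negative real part. -/
def IsAsymptoticallyStable (E A : Matrix n n ℂ) : Prop :=
  IsRegularPencil E A ∧ ∀ z ∈ pencilSpectrum E A, z.re < 0

/-- The transfer function `G(s) = C (s E - A)⁻¹ B` of the system `E x' = A x + B u`, `y = C x`. -/
noncomputable def transferFunction (E A : Matrix n n ℂ) (B : Matrix n m ℂ) (C : Matrix p n ℂ) :
    ℂ → Matrix p m ℂ :=
  fun s => C * (s • E - A)⁻¹ * B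

/-- `G` is strictly proper: `G(s) → 0` as `|s| → ∞`. -/
def IsStrictlyProper (G : ℂ → Matrix p m ℂ) : Prop :=
  Tendsto G (Bornology.cobounded ℂ) (𝓝 0)

/-- `G` is a rational matrix-valued function: away from the zeros of a common denominator `d`,
it is the quotient of a matrix of polynomials by `d`. -/
def IsRational (G : ℂ → Matrix p m ℂ) : Prop :=
  ∃ (d : Polynomial ℂ) (N : Matrix p m (Polynomial ℂ)), d ≠ 0 ∧
    ∀ s : ℂ, d.eval s ≠ 0 → ∀ i j, G s i j = (N i j).eval s / d.eval s

/-- The square of the Frobenius norm. -/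
noncomputable def frobeniusSq (M : Matrix p m ℂ) : ℝ :=
  ∑ i, ∑ j, ‖M i j‖ ^ 2

/-- The space `H₂`: rational functions which are analytic in the closed right half-plane and
square integrable, in Frobenius norm, on the imaginary axis. -/
structure MemH2 (G : ℂ → Matrix p m ℂ) : Prop where
  rational : IsRational G
  analytic : ∀ i j, AnalyticOnNhd ℂ (fun s => G s i j) {s : ℂ | 0 ≤ s.re}
  square_integrable : Integrable (fun ω : ℝ => frobeniusSq (G (Complex.I * ω))) volume

/-- The `H₂` norm `((1 / 2π) ∫ ‖G(iω)‖_F² dω)^(1/2)` (meaningful for `G` in `H₂`). -/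
noncomputable def h2Norm (G : ℂ → Matrix p m ℂ) : ℝ :=
  Real.sqrt (1 / (2 * Real.pi) * ∫ ω : ℝ, frobeniusSq (G (Complex.I * ω)))

/-- The set of all transfer functions `C_M (s I - A_M)⁻¹ B_M` with a free output matrix `C_M`. -/
def transferSubspace (p : Type*) (AM : Matrix q q ℂ) (BM : Matrix q m ℂ) :
    Set (ℂ → Matrix p m ℂ) :=
  {GM | ∃ CM : Matrix p q ℂ, GM = transferFunction 1 AM BM CM}

/-- `Gr` is an `H₂` pseudo-optimal reduced model of `G` with respect to the subspace given by
`(A_M, B_M)`: it minimizes the `H₂` error over that subspace. -/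
structure IsH2PseudoOptimal (G : ℂ → Matrix p m ℂ) (AM : Matrix q q ℂ) (BM : Matrix q m ℂ)
    (Gr : ℂ → Matrix p m ℂ) : Prop where
  mem : Gr ∈ transferSubspace p AM BM
  le : ∀ GM ∈ transferSubspace p AM BM, h2Norm (G - Gr) ≤ h2Norm (G - GM)

/-- `(S, R)` represents right tangential interpolation data for a system with pencil `λ E - A`:
`S` is diagonalized by some `T` with distinct eigenvalues, none of which is a generalized
eigenvalue of the pencil, and all columns of `R T⁻¹` (the tangential directions) are nonzero. -/
def IsRightTangentialData (E A : Matrix n n ℂ) (S : Matrix q q ℂ) (R : Matrix m q ℂ) : Prop :=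
  ∃ (T : Matrix q q ℂ) (σ : q → ℂ), IsUnit T.det ∧ Function.Injective σ ∧
    T * S * T⁻¹ = Matrix.diagonal σ ∧ (∀ i, σ i ∉ pencilSpectrum E A) ∧
    ∀ i, (R * T⁻¹).col i ≠ 0

end DAE

/-! Write t_k for the k-th column of T⁻¹, an eigenvector of S for σ_k, and r_k = R t_k for the
tangential direction. Members of 𝒢(-S*, R*) are combinations of the functions (s + conj σ_k)⁻¹ r_k*.
On the imaginary axis the conjugate of (s + conj σ_k)⁻¹ is (σ_k - s)⁻¹, so pairing F with such a
term integrates F(s) r_k / (σ_k - s). If F(σ_k) r_k = 0, the singularity at σ_k is removable, the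
integrand is analytic in the closed right half-plane and O(s⁻²), and Cauchy's theorem gives zero.
Thus an error that interpolates zero at all σ_k along r_k is orthogonal to 𝒢
(`integral_inner_eq_zero`). Pythagoras then yields optimality, and definiteness of the norm yields
uniqueness.

The interpolating member is explicit. The Sylvester equation applied to t_k gives G(σ_k) r_k = -C V
t_k; the Lyapunov equation shows that the member with output matrix D sends r_k to D P t_k at σ_k.
Hence D P = -C V, and D = -C V P⁻¹ is the reduced model with the factor P cancelled.

P is invertible (`isUnit_det_of_lyapunov`) because its kernel is S-invariant and lies in ker R,
while no eigenvector of S does. -/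

namespace DAE

open Asymptotics Bornology Complex

/-! ### Decay at infinity and Cauchy's theorem on the right half-plane -/

/-- A function which is differentiable near infinity and tends to zero there is `O(1/s)`. -/
theorem isBigO_inv_of_tendsto_zero {f : ℂ → ℂ}
    (hd : ∀ᶠ s in cobounded ℂ, DifferentiableAt ℂ f s)
    (h0 : Tendsto f (cobounded ℂ) (𝓝 0)) :
    f =O[cobounded ℂ] (fun s => s⁻¹) := by
  -- Inversion moves infinity to 0. With the value 0 there, g is continuous, so the singularity is
  -- removable, and g(z) = O(z) since g(0) = 0.
  set g : ℂ → ℂ := Function.update (fun z => f z⁻¹) 0 0 with hg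
  have hgeq : ∀ z, z ≠ 0 → g z = f z⁻¹ := fun z hz => by simp [hg, hz]
  have hg0 : g 0 = 0 := by simp [hg]
  have htend : Tendsto (fun z : ℂ => z⁻¹) (𝓝[≠] 0) (cobounded ℂ) := tendsto_inv₀_nhdsNE_zero
  have hcont : ContinuousAt g 0 := by
    rw [hg, continuousAt_update_same]
    exact h0.comp htend
  have hdiff : ∀ᶠ z in 𝓝[≠] (0 : ℂ), DifferentiableAt ℂ g z := by
    filter_upwards [htend.eventually hd, self_mem_nhdsWithin] with z hz hz0
    have hz0 : z ≠ 0 := hz0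
    have h1 : DifferentiableAt ℂ (fun z => f z⁻¹) z :=
      DifferentiableAt.comp (g := f) z hz (differentiableAt_inv hz0)
    refine h1.congr_of_eventuallyEq ?_
    filter_upwards [isOpen_ne.mem_nhds hz0] with w hw
    exact hgeq w hw
  have han := Complex.analyticAt_of_differentiable_on_punctured_nhds_of_continuousAt hdiff hcont
  have hO : g =O[𝓝 0] (fun z => z) := by
    have := han.differentiableAt.isBigO_sub
    simpa [hg0] using this
  have htend' : Tendsto (fun z : ℂ => z⁻¹) (cobounded ℂ) (𝓝 0) := tendsto_inv₀_cobounded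
  refine (hO.comp_tendsto htend').congr' ?_ ?_
  · filter_upwards [eventually_ne_cobounded (0 : ℂ)] with s hs
    simp [hgeq _ (inv_ne_zero hs)]
  · exact Eventually.of_forall fun s => rfl

/-- The imaginary axis tends to infinity at both ends. -/
theorem tendsto_I_mul_cocompact :
    Tendsto (fun ω : ℝ => I * (ω : ℂ)) (cocompact ℝ) (cobounded ℂ) := by
  rw [← Metric.cobounded_eq_cocompact]
  rw [← tendsto_norm_atTop_iff_cobounded]
  simp only [norm_mul, norm_I, one_mul, Complex.norm_real]
  exact tendsto_norm_cobounded_atTop (E := ℝ)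

/-- A continuous function on the line which is `O(1/ω²)` is integrable. -/
theorem integrable_of_isBigO_inv_sq {E : Type*} [NormedAddCommGroup E] {u : ℝ → E}
    (hc : Continuous u) (hO : u =O[cocompact ℝ] (fun ω : ℝ => ((I * (ω : ℂ))⁻¹) ^ 2)) :
    Integrable u := by
  refine hc.locallyIntegrable.integrable_of_isBigO_cocompact
    (g := fun ω : ℝ => (1 + ω ^ 2)⁻¹) (hO.trans ?_) (integrable_inv_one_add_sq.integrableAtFilter _)
  -- The constant 2 comes from 1 + ω² ≤ 2ω² for |ω| ≥ 1.
  refine IsBigO.of_bound 2 ?_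
  have h1 : ∀ᶠ ω : ℝ in cocompact ℝ, 1 ≤ ‖ω‖ := by
    rw [← Metric.cobounded_eq_cocompact]
    exact tendsto_norm_cobounded_atTop.eventually_ge_atTop 1
  filter_upwards [h1] with ω hω
  have h2 : 1 ≤ ω ^ 2 := by
    rw [← sq_abs]; rw [Real.norm_eq_abs] at hω; nlinarith
  have h3 : ‖((I * (ω : ℂ))⁻¹) ^ 2‖ = (ω ^ 2)⁻¹ := by simp
  rw [h3, Real.norm_of_nonneg (by positivity), ← div_eq_mul_inv,
    inv_le_comm₀ (by positivity) (by positivity), inv_div]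
  linarith

/-- Cauchy's theorem for the right half-plane: a function which is analytic in the closed right
half-plane and `O(1/s²)` has integral zero along the imaginary axis. -/
theorem integral_imaginary_axis_eq_zero {h : ℂ → ℂ}
    (ha : AnalyticOnNhd ℂ h {s : ℂ | 0 ≤ s.re})
    (hO : h =O[cobounded ℂ] (fun s => s⁻¹ ^ 2)) :
    ∫ ω : ℝ, h (I * ω) = 0 := by
  have hcont : Continuous (fun ω : ℝ => h (I * ω)) := by
    rw [continuous_iff_continuousAt]
    intro ω
    have h1 : ContinuousAt h (I * ω) := (ha (I * ω) (by simp)).continuousAt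
    exact ContinuousAt.comp (f := fun ω : ℝ => I * (ω : ℂ)) h1 (by fun_prop)
  have hint : Integrable (fun ω : ℝ => h (I * ω)) :=
    integrable_of_isBigO_inv_sq hcont (hO.comp_tendsto tendsto_I_mul_cocompact)
  have hlim := intervalIntegral_tendsto_integral hint tendsto_neg_atTop_atBot tendsto_id
  refine tendsto_nhds_unique hlim ?_
  obtain ⟨c, hc⟩ := hO.bound
  obtain ⟨r, -, hr⟩ := (hasBasis_cobounded_norm (E := ℂ)).eventually_iff.1 hc
  have hb : ∀ T : ℝ, 0 < T → ∀ s : ℂ, r ≤ T → T ≤ ‖s‖ → ‖h s‖ ≤ |c| * (T⁻¹) ^ 2 := by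
    intro T hT s hrT hs
    refine (hr (hrT.trans hs)).trans ?_
    rw [norm_pow, norm_inv]
    gcongr
    exact le_abs_self c
  have hz : Tendsto (fun T : ℝ => 4 * |c| * T⁻¹) atTop (𝓝 0) := by
    simpa using (tendsto_inv_atTop_zero (𝕜 := ℝ)).const_mul (4 * |c|)
  refine squeeze_zero_norm' ?_ hz
  filter_upwards [eventually_ge_atTop r, eventually_gt_atTop (0 : ℝ)] with T hrT hT
  -- The rectangle [0, T] × [-T, T]. Its three sides off the axis have lengths T, T, 2T and stay at
  -- distance at least T from 0, so together they contribute at most 4|c|/T.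
  have hrect := Complex.integral_boundary_rect_eq_zero_of_differentiableOn h (-(I * T))
    (T + I * T) (by
    intro s hs
    refine (ha s ?_).differentiableAt.differentiableWithinAt
    have := hs.1
    simp only [Set.mem_preimage, neg_re, mul_re, I_re, ofReal_re, zero_mul, I_im, ofReal_im,
      mul_zero, sub_self, neg_zero, add_re, add_zero] at this
    rw [Set.uIcc_of_le hT.le] at this
    exact this.1)
  simp only [neg_re, mul_re, I_re, ofReal_re, zero_mul, I_im, ofReal_im, mul_zero, sub_self,
    neg_zero, add_re, add_zero, neg_im, mul_im, one_mul, add_im, zero_add, ofReal_zero,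
    smul_eq_mul] at hrect
  have e1 : ‖∫ x in (0 : ℝ)..T, h (x + ((-T : ℝ) : ℂ) * I)‖ ≤ |c| * (T⁻¹) ^ 2 * |T - 0| := by
    refine intervalIntegral.norm_integral_le_of_norm_le_const fun x _ => hb T hT _ hrT ?_
    refine le_trans ?_ (Complex.abs_im_le_norm _)
    simp [le_abs_self]
  have e2 : ‖∫ x in (0 : ℝ)..T, h (x + (T : ℂ) * I)‖ ≤ |c| * (T⁻¹) ^ 2 * |T - 0| := by
    refine intervalIntegral.norm_integral_le_of_norm_le_const fun x _ => hb T hT _ hrT ?_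
    refine le_trans ?_ (Complex.abs_im_le_norm _)
    simp [le_abs_self]
  have e3 : ‖∫ y in (-T)..T, h (T + (y : ℂ) * I)‖ ≤ |c| * (T⁻¹) ^ 2 * |T - -T| := by
    refine intervalIntegral.norm_integral_le_of_norm_le_const fun x _ => hb T hT _ hrT ?_
    refine le_trans ?_ (Complex.abs_re_le_norm _)
    simp [le_abs_self]
  have e4 : (∫ y in (-T)..T, h (I * y)) = ∫ y in (-T)..T, h ((y : ℂ) * I) := by
    simp only [mul_comm]
  have e5 : I * (∫ y in (-T)..T, h ((y : ℂ) * I)) =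
      (∫ x in (0 : ℝ)..T, h (x + ((-T : ℝ) : ℂ) * I)) - (∫ x in (0 : ℝ)..T, h (x + (T : ℂ) * I))
        + I * ∫ y in (-T)..T, h (T + (y : ℂ) * I) := by
    rw [sub_eq_zero] at hrect
    exact hrect.symm
  have e6 : ‖∫ y in (-T)..T, h (I * y)‖ = ‖I * (∫ y in (-T)..T, h ((y : ℂ) * I))‖ := by
    rw [e4]; simp
  have e7 : |T - 0| = T := by simp [abs_of_pos hT]
  have e8 : |T - -T| = 2 * T := by rw [abs_of_pos] <;> linarith
  rw [e7] at e1 e2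
  rw [e8] at e3
  simp only [id]
  rw [e6, e5]
  have e9 : |c| * (T⁻¹) ^ 2 * T = |c| * T⁻¹ := by field_simp
  calc _ ≤ ‖∫ x in (0 : ℝ)..T, h (x + ((-T : ℝ) : ℂ) * I)‖
        + ‖∫ x in (0 : ℝ)..T, h (x + (T : ℂ) * I)‖
        + ‖I * ∫ y in (-T)..T, h (T + (y : ℂ) * I)‖ :=
          (norm_add_le _ _).trans (by gcongr; exact norm_sub_le _ _)
    _ ≤ |c| * (T⁻¹) ^ 2 * T + |c| * (T⁻¹) ^ 2 * T + |c| * (T⁻¹) ^ 2 * (2 * T) := by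
          rw [norm_mul, norm_I, one_mul]; gcongr
    _ = 4 * |c| * T⁻¹ := by linear_combination 4 * e9

/-! ### Decaying functions and orthogonality to a simple pole -/

/-- Functions which are analytic in the closed right half-plane and `O(1/s)` at infinity. -/
structure IsDecaying (f : ℂ → ℂ) : Prop where
  analytic : AnalyticOnNhd ℂ f {s : ℂ | 0 ≤ s.re}
  isBigO : f =O[cobounded ℂ] (fun s => s⁻¹)

namespace IsDecaying

theorem sub {f g : ℂ → ℂ} (hf : IsDecaying f) (hg : IsDecaying g) :
    IsDecaying (fun s => f s - g s) :=
  ⟨hf.analytic.sub hg.analytic, hf.isBigO.sub hg.isBigO⟩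

theorem mul_const {f : ℂ → ℂ} (hf : IsDecaying f) (c : ℂ) : IsDecaying (fun s => f s * c) :=
  ⟨hf.analytic.mul analyticOnNhd_const,
    by simpa [mul_comm] using hf.isBigO.const_mul_left c⟩

theorem sum {ι : Type*} (t : Finset ι) {f : ι → ℂ → ℂ} (hf : ∀ i, IsDecaying (f i)) :
    IsDecaying (fun s => ∑ i ∈ t, f i s) :=
  ⟨Finset.analyticOnNhd_fun_sum t fun i _ => (hf i).analytic,
    IsBigO.fun_sum fun i _ => (hf i).isBigO⟩

theorem continuous_axis {f : ℂ → ℂ} (hf : IsDecaying f) :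
    Continuous (fun ω : ℝ => f (I * ω)) := by
  rw [continuous_iff_continuousAt]
  intro ω
  have h1 : ContinuousAt f (I * ω) := (hf.analytic (I * ω) (by simp)).continuousAt
  exact ContinuousAt.comp (f := fun ω : ℝ => I * (ω : ℂ)) h1 (by fun_prop)

theorem isBigO_axis {f : ℂ → ℂ} (hf : IsDecaying f) :
    (fun ω : ℝ => f (I * ω)) =O[cocompact ℝ] (fun ω : ℝ => (I * (ω : ℂ))⁻¹) :=
  hf.isBigO.comp_tendsto tendsto_I_mul_cocompact

theorem integrable_mul_conj {f g : ℂ → ℂ} (hf : IsDecaying f) (hg : IsDecaying g) :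
    Integrable (fun ω : ℝ => f (I * ω) * star (g (I * ω))) := by
  refine integrable_of_isBigO_inv_sq (hf.continuous_axis.mul hg.continuous_axis.star) ?_
  simp only [pow_two]
  refine hf.isBigO_axis.mul (IsBigO.trans ?_ hg.isBigO_axis)
  exact IsBigO.of_bound 1 (Eventually.of_forall fun ω => by simp)

theorem integrable_normSq {f : ℂ → ℂ} (hf : IsDecaying f) :
    Integrable (fun ω : ℝ => ‖f (I * ω)‖ ^ 2) := by
  have := (hf.integrable_mul_conj hf).norm
  simpa [pow_two] using this

end IsDecaying

theorem isBigO_inv_add_const (a : ℂ) :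
    (fun s : ℂ => (s + a)⁻¹) =O[cobounded ℂ] (fun s => s⁻¹) := by
  refine isBigO_inv_of_tendsto_zero ?_ ?_
  · filter_upwards [eventually_ne_cobounded (-a)] with s hs
    have : s + a ≠ 0 := fun h => hs (eq_neg_of_add_eq_zero_left h)
    fun_prop (disch := assumption)
  · exact tendsto_inv₀_cobounded.comp (tendsto_add_const_cobounded a)

/-- The functions `1 / (s + a)` with `0 < re a` are decaying. -/
theorem isDecaying_inv_add {a : ℂ} (ha : 0 < a.re) : IsDecaying (fun s => (s + a)⁻¹) := by
  refine ⟨fun s hs => ?_, isBigO_inv_add_const a⟩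
  have : s + a ≠ 0 := fun h => by
    have h' := congrArg Complex.re h
    have hs : 0 ≤ s.re := hs
    simp at h'
    linarith
  exact (analyticAt_id.add analyticAt_const).inv this

/-- A decaying function which vanishes at `σ` is orthogonal to `1 / (s + conj σ)`. -/
theorem IsDecaying.integral_eq_zero {f : ℂ → ℂ} (hf : IsDecaying f) {σ : ℂ} (hσ : 0 < σ.re)
    (h0 : f σ = 0) : ∫ ω : ℝ, f (I * ω) * (σ - I * ω)⁻¹ = 0 := by
  have hne : ∀ s : ℂ, s ≠ σ → dslope f σ s = f s * (s - σ)⁻¹ := fun s hs => by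
    rw [dslope_of_ne _ hs, slope_def_field, h0, sub_zero, div_eq_mul_inv]
  -- Since f σ = 0, `dslope f σ` is f(s)/(s - σ) with its singularity removed; the extra factor
  -- improves O(1/s) to O(1/s²).
  have key : ∫ ω : ℝ, dslope f σ (I * ω) = 0 := by
    refine integral_imaginary_axis_eq_zero ?_ ?_
    · intro s hs
      by_cases h : s = σ
      · subst h
        obtain ⟨p, hp⟩ := hf.analytic s hs
        exact ⟨_, hp.has_fpower_series_dslope_fslope⟩
      · have h1 : AnalyticAt ℂ (fun s => f s * (s - σ)⁻¹) s :=
          (hf.analytic s hs).mul ((analyticAt_id.sub analyticAt_const).inv (sub_ne_zero.2 h))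
        refine h1.congr ?_
        filter_upwards [isOpen_ne.mem_nhds h] with w hw
        exact (hne w hw).symm
    · have h2 := hf.isBigO.mul (isBigO_inv_add_const (-σ))
      refine h2.congr' ?_ (Eventually.of_forall fun s => (pow_two _).symm)
      filter_upwards [eventually_ne_cobounded σ] with s hs
      rw [hne s hs, sub_eq_add_neg]
  have h3 : ∀ ω : ℝ, f (I * ω) * (σ - I * ω)⁻¹ = - dslope f σ (I * ω) := fun ω => by
    rw [hne, ← neg_sub σ, inv_neg, mul_neg, neg_neg]
    rintro h
    rw [← h] at hσ
    simp at hσ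
  simp only [h3, integral_neg, key, neg_zero]

/-! ### Rationality of transfer functions and membership in H₂ -/

section Pencil

variable {n p m : Type*} [Fintype n] [DecidableEq n]

/-- The characteristic polynomial `det (λ E - A)` of a pencil. -/
noncomputable def pencilPoly (E A : Matrix n n ℂ) : Polynomial ℂ :=
  (E.map (fun z => Polynomial.X * Polynomial.C z) - A.map Polynomial.C).det

theorem map_eval_pencil (E A : Matrix n n ℂ) (s : ℂ) :
    (Polynomial.evalRingHom s).mapMatrix
      (E.map (fun z => Polynomial.X * Polynomial.C z) - A.map Polynomial.C) = s • E - A := by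
  ext i j
  simp
  ring

theorem eval_pencilPoly (E A : Matrix n n ℂ) (s : ℂ) :
    (pencilPoly E A).eval s = (s • E - A).det := by
  rw [← map_eval_pencil, ← RingHom.map_det]
  rfl

theorem pencilPoly_ne_zero {E A : Matrix n n ℂ} (h : IsRegularPencil E A) :
    pencilPoly E A ≠ 0 := by
  obtain ⟨z, hz⟩ := h
  rintro h0
  rw [← eval_pencilPoly, h0] at hz
  simp at hz

/-- The entries of a transfer function are quotients of polynomials by the characteristic
polynomial of the pencil. -/
theorem exists_transferFunction_eq_div (E A : Matrix n n ℂ) (B : Matrix n m ℂ)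
    (C : Matrix p n ℂ) : ∃ N : Matrix p m (Polynomial ℂ), ∀ s i j,
      transferFunction E A B C s i j = (N i j).eval s / (pencilPoly E A).eval s := by
  refine ⟨C.map Polynomial.C *
    (E.map (fun z => Polynomial.X * Polynomial.C z) - A.map Polynomial.C).adjugate *
    B.map Polynomial.C, fun s i j => ?_⟩
  have h1 : ∀ k l, ((E.map (fun z => Polynomial.X * Polynomial.C z)
      - A.map Polynomial.C).adjugate k l).eval s = (s • E - A).adjugate k l := fun k l => by
    rw [← map_eval_pencil, ← RingHom.map_adjugate]
    rfl
  -- Cramer's rule. The identity survives a singular pencil: both the matrix inverse and division by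
  -- zero default to 0.
  rw [eval_pencilPoly, transferFunction, Matrix.inv_def, Ring.inverse_eq_inv']
  simp only [Matrix.mul_apply, Matrix.smul_apply, smul_eq_mul, Polynomial.eval_finsetSum,
    Polynomial.eval_mul, Matrix.map_apply, Polynomial.eval_C, h1, div_eq_mul_inv,
    Finset.sum_mul]
  refine Finset.sum_congr rfl fun k _ => Finset.sum_congr rfl fun l _ => ?_
  ring

theorem isRational_transferFunction {E A : Matrix n n ℂ} (h : IsRegularPencil E A)
    (B : Matrix n m ℂ) (C : Matrix p n ℂ) : IsRational (transferFunction E A B C) := by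
  obtain ⟨N, hN⟩ := exists_transferFunction_eq_div E A B C
  exact ⟨_, N, pencilPoly_ne_zero h, fun s _ i j => hN s i j⟩

theorem det_ne_zero_of_nonneg_re {E A : Matrix n n ℂ} (h : IsAsymptoticallyStable E A) {s : ℂ}
    (hs : 0 ≤ s.re) : (s • E - A).det ≠ 0 :=
  fun h0 => (h.2 s h0).not_ge hs

theorem eventually_cobounded_eval_ne_zero {d : Polynomial ℂ} (hd : d ≠ 0) :
    ∀ᶠ s in cobounded ℂ, d.eval s ≠ 0 := by
  have h1 : {s | d.IsRoot s}.Finite := Polynomial.finite_setOfPred_isRoot hd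
  exact h1.isBounded

/-- Strict properness only says that the limit is zero. Rationality supplies differentiability
outside finitely many points, which upgrades this to O(1/s), enough for square integrability. -/
theorem isDecaying_transferFunction [Fintype p] [Fintype m] {E A : Matrix n n ℂ}
    (h : IsAsymptoticallyStable E A) {B : Matrix n m ℂ} {C : Matrix p n ℂ}
    (hG : IsStrictlyProper (transferFunction E A B C)) (i : p) (j : m) :
    IsDecaying (fun s => transferFunction E A B C s i j) := by
  obtain ⟨N, hN⟩ := exists_transferFunction_eq_div E A B C
  have hfun : (fun s => transferFunction E A B C s i j) =
      fun s => (N i j).eval s / (pencilPoly E A).eval s := funext fun s => hN s i j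
  have han : ∀ s, (pencilPoly E A).eval s ≠ 0 →
      AnalyticAt ℂ (fun s => (N i j).eval s / (pencilPoly E A).eval s) s := fun s hs => by
    refine AnalyticAt.div ?_ ?_ hs
    · exact (N i j).differentiable.analyticAt s
    · exact (pencilPoly E A).differentiable.analyticAt s
  constructor
  · intro s hs
    rw [hfun]
    refine han s ?_
    rw [eval_pencilPoly]
    exact det_ne_zero_of_nonneg_re h hs
  · refine isBigO_inv_of_tendsto_zero ?_ ?_
    · rw [hfun]
      filter_upwards [eventually_cobounded_eval_ne_zero (pencilPoly_ne_zero h.1)] with s hs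
      exact (han s hs).differentiableAt
    · exact (tendsto_pi_nhds.1 (tendsto_pi_nhds.1 hG i) j)

theorem memH2_transferFunction [Fintype p] [Fintype m] {E A : Matrix n n ℂ}
    (h : IsAsymptoticallyStable E A) {B : Matrix n m ℂ} {C : Matrix p n ℂ}
    (hG : IsStrictlyProper (transferFunction E A B C)) :
    MemH2 (transferFunction E A B C) := by
  have hd := isDecaying_transferFunction h hG
  refine ⟨isRational_transferFunction h.1 B C, fun i j => (hd i j).analytic, ?_⟩
  unfold frobeniusSq
  exact integrable_finsetSum _ fun i _ => integrable_finsetSum _ fun j _ =>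
    (hd i j).integrable_normSq

end Pencil

/-! ### Pythagoras and definiteness of the H₂ norm -/

section H2

variable {p m : Type*} [Fintype p] [Fintype m]

theorem frobeniusSq_nonneg (M : Matrix p m ℂ) : 0 ≤ frobeniusSq M := by
  unfold frobeniusSq; positivity

theorem eq_zero_of_frobeniusSq_eq_zero {M : Matrix p m ℂ} (h : frobeniusSq M = 0) : M = 0 := by
  unfold frobeniusSq at h
  ext i j
  rw [Finset.sum_eq_zero_iff_of_nonneg fun i _ => by positivity] at h
  have h2 := h i (Finset.mem_univ i)
  rw [Finset.sum_eq_zero_iff_of_nonneg fun i _ => by positivity] at h2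
  simpa using h2 j (Finset.mem_univ j)

theorem frobeniusSq_add (M N : Matrix p m ℂ) :
    frobeniusSq (M + N) =
      frobeniusSq M + frobeniusSq N + 2 * (∑ i, ∑ j, M i j * star (N i j)).re := by
  unfold frobeniusSq
  simp only [Complex.re_sum, Finset.mul_sum, ← Finset.sum_add_distrib]
  refine Finset.sum_congr rfl fun i _ => Finset.sum_congr rfl fun j _ => ?_
  simp only [Matrix.add_apply, ← Complex.normSq_eq_norm_sq, Complex.normSq_apply,
    Complex.star_def, Complex.mul_re, Complex.add_re, Complex.add_im, Complex.conj_re,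
    Complex.conj_im]
  ring

variable {F K : ℂ → Matrix p m ℂ}

theorem integrable_frobeniusSq (hF : ∀ i j, IsDecaying (fun s => F s i j)) :
    Integrable (fun ω : ℝ => frobeniusSq (F (I * ω))) := by
  unfold frobeniusSq
  exact integrable_finsetSum _ fun i _ => integrable_finsetSum _ fun j _ =>
    (hF i j).integrable_normSq

/-- The theorem of Pythagoras in `H₂`. -/
theorem integral_frobeniusSq_add (hF : ∀ i j, IsDecaying (fun s => F s i j))
    (hK : ∀ i j, IsDecaying (fun s => K s i j))
    (hFK : ∫ ω : ℝ, ∑ i, ∑ j, F (I * ω) i j * star (K (I * ω) i j) = 0) :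
    ∫ ω : ℝ, frobeniusSq ((F + K) (I * ω)) =
      (∫ ω : ℝ, frobeniusSq (F (I * ω))) + ∫ ω : ℝ, frobeniusSq (K (I * ω)) := by
  have h1 : Integrable (fun ω : ℝ => ∑ i, ∑ j, F (I * ω) i j * star (K (I * ω) i j)) :=
    integrable_finsetSum _ fun i _ => integrable_finsetSum _ fun j _ =>
      (hF i j).integrable_mul_conj (hK i j)
  have h2 : ∫ ω : ℝ, (∑ i, ∑ j, F (I * ω) i j * star (K (I * ω) i j)).re = 0 := by
    have := integral_re h1
    simp only [RCLike.re_eq_complex_re] at this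
    rw [this, hFK, Complex.zero_re]
  have h3 : Integrable
      (fun ω : ℝ => 2 * (∑ i, ∑ j, F (I * ω) i j * star (K (I * ω) i j)).re) :=
    h1.re.const_mul 2
  have h4 : Integrable (fun ω : ℝ => frobeniusSq (F (I * ω)) + frobeniusSq (K (I * ω))) :=
    (integrable_frobeniusSq hF).add (integrable_frobeniusSq hK)
  have h5 : ∀ ω : ℝ, frobeniusSq ((F + K) (I * ω)) =
      frobeniusSq (F (I * ω)) + frobeniusSq (K (I * ω)) +
        2 * (∑ i, ∑ j, F (I * ω) i j * star (K (I * ω) i j)).re := fun ω => frobeniusSq_add _ _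
  rw [integral_congr_ae (Eventually.of_forall h5), integral_add h4 h3,
    integral_add (integrable_frobeniusSq hF) (integrable_frobeniusSq hK),
    integral_const_mul, h2, mul_zero, add_zero]

/-- A decaying function with zero `H₂` norm vanishes on the imaginary axis, hence in the whole
closed right half-plane. -/
theorem eq_zero_of_integral_frobeniusSq_eq_zero (hK : ∀ i j, IsDecaying (fun s => K s i j))
    (h0 : ∫ ω : ℝ, frobeniusSq (K (I * ω)) = 0) {s : ℂ} (hs : 0 ≤ s.re) : K s = 0 := by
  have hc : Continuous (fun ω : ℝ => frobeniusSq (K (I * ω))) := by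
    unfold frobeniusSq
    exact continuous_finsetSum _ fun i _ => continuous_finsetSum _ fun j _ =>
      (hK i j).continuous_axis.norm.pow 2
  rw [integral_eq_zero_iff_of_nonneg (fun ω => frobeniusSq_nonneg _)
    (integrable_frobeniusSq hK)] at h0
  have h1 := (Continuous.ae_eq_iff_eq volume hc continuous_const).1 h0
  have haxis : ∀ ω : ℝ, K (I * ω) = 0 := fun ω =>
    eq_zero_of_frobeniusSq_eq_zero (congrFun h1 ω)
  ext i j
  have hpre : IsPreconnected {s : ℂ | 0 ≤ s.re} := (convex_halfSpace_re_ge 0).isPreconnected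
  refine (hK i j).analytic.eqOn_zero_of_preconnected_of_frequently_eq_zero hpre
    (z₀ := 0) (by simp) ?_ hs
  -- The axis accumulates at 0, so the identity theorem applies there.
  have ht : Tendsto (fun ω : ℝ => I * (ω : ℂ)) (𝓝[≠] 0) (𝓝[≠] 0) := by
    refine tendsto_nhdsWithin_iff.2 ⟨?_, ?_⟩
    · refine Tendsto.mono_left ?_ nhdsWithin_le_nhds
      exact (Continuous.tendsto' (by fun_prop) _ _ (by simp))
    · filter_upwards [self_mem_nhdsWithin] with ω hω
      have : ω ≠ 0 := hω
      simpa using this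
  refine ht.frequently (Eventually.frequently (Eventually.of_forall fun ω => ?_))
  rw [haxis]; rfl

end H2

/-! ### The Lyapunov equation in the eigenbasis of S -/

section Diag

variable {q m p : Type*} [Fintype q] [DecidableEq q]
  {S T : Matrix q q ℂ} {σ : q → ℂ} {R : Matrix m q ℂ} {P : Matrix q q ℂ}

theorem mul_inv_eq_inv_mul_diagonal (hT : IsUnit T.det) (hd : T * S * T⁻¹ = diagonal σ) :
    S * T⁻¹ = T⁻¹ * diagonal σ := by
  rw [← hd, ← Matrix.mul_assoc, ← Matrix.mul_assoc, Matrix.nonsing_inv_mul _ hT, Matrix.one_mul]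

theorem mulVec_eigenvector (hT : IsUnit T.det) (hd : T * S * T⁻¹ = diagonal σ) (k : q) :
    S *ᵥ T⁻¹.col k = σ k • T⁻¹.col k := by
  have h := congrArg (fun M : Matrix q q ℂ => M.col k) (mul_inv_eq_inv_mul_diagonal hT hd)
  ext i
  have h' := congrFun h i
  simp only [Matrix.col_apply, Matrix.mul_diagonal] at h'
  rw [Matrix.mul_apply] at h'
  simpa [Matrix.mulVec, dotProduct, mul_comm] using h'

theorem eigenvector_ne_zero (hT : IsUnit T.det) (k : q) : T⁻¹.col k ≠ 0 := by
  intro h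
  have h1 : (T * T⁻¹) k k = 1 := by rw [Matrix.mul_nonsing_inv _ hT, Matrix.one_apply_eq]
  have h2 : ∀ i, T⁻¹ i k = 0 := fun i => congrFun h i
  simp [Matrix.mul_apply, h2] at h1

theorem re_pos_of_spectrum (hT : IsUnit T.det) (hd : T * S * T⁻¹ = diagonal σ)
    (hS : ∀ z ∈ spectrum ℂ S, 0 < z.re) (k : q) : 0 < (σ k).re := by
  refine hS _ ?_
  rw [← Matrix.spectrum_toLin']
  refine Module.End.HasEigenvalue.mem_spectrum ?_
  refine Module.End.hasEigenvalue_of_hasEigenvector (x := T⁻¹.col k) ⟨?_, eigenvector_ne_zero hT k⟩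
  rw [Module.End.mem_eigenspace_iff, Matrix.toLin'_apply, mulVec_eigenvector hT hd]

/-- The only solution of the homogeneous Lyapunov equation is zero. -/
theorem eq_zero_of_lyapunov (hT : IsUnit T.det) (hd : T * S * T⁻¹ = diagonal σ)
    (hσ : ∀ k, 0 < (σ k).re) {X : Matrix q q ℂ} (hX : Sᴴ * X + X * S = 0) : X = 0 := by
  have h1 := mul_inv_eq_inv_mul_diagonal hT hd
  have h2 : (T⁻¹)ᴴ * Sᴴ = diagonal (star σ) * (T⁻¹)ᴴ := by
    rw [← Matrix.conjTranspose_mul, h1, Matrix.conjTranspose_mul, Matrix.diagonal_conjTranspose]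
  -- Congruence by T⁻¹ decouples the equation into (conj σ_i + σ_j) X̃_ij = 0, whose coefficients
  -- have positive real part.
  have h3 : diagonal (star σ) * ((T⁻¹)ᴴ * X * T⁻¹) + ((T⁻¹)ᴴ * X * T⁻¹) * diagonal σ = 0 := by
    calc _ = (diagonal (star σ) * (T⁻¹)ᴴ) * X * T⁻¹ + (T⁻¹)ᴴ * X * (T⁻¹ * diagonal σ) := by
          simp only [Matrix.mul_assoc]
      _ = (T⁻¹)ᴴ * (Sᴴ * X + X * S) * T⁻¹ := by
          rw [← h1, ← h2]
          simp only [Matrix.mul_add, Matrix.add_mul, Matrix.mul_assoc]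
      _ = 0 := by rw [hX]; simp
  have h4 : (T⁻¹)ᴴ * X * T⁻¹ = 0 := by
    ext i j
    have h5 := congrFun (congrFun h3 i) j
    simp only [Matrix.add_apply, Matrix.diagonal_mul, Matrix.mul_diagonal, Matrix.zero_apply,
      Pi.star_apply] at h5
    have h6 : star (σ i) + σ j ≠ 0 := fun h => by
      have h' := congrArg Complex.re h
      have := hσ i
      have := hσ j
      simp at h'
      linarith
    have h7 : (star (σ i) + σ j) * ((T⁻¹)ᴴ * X * T⁻¹) i j = 0 := by linear_combination h5
    exact (mul_eq_zero.1 h7).resolve_left h6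
  have h5 : (T)ᴴ * (T⁻¹)ᴴ = 1 := by
    rw [← Matrix.conjTranspose_mul, Matrix.nonsing_inv_mul _ hT, Matrix.conjTranspose_one]
  calc X = (T)ᴴ * (T⁻¹)ᴴ * X * (T⁻¹ * T) := by
        rw [h5, Matrix.nonsing_inv_mul _ hT, Matrix.one_mul, Matrix.mul_one]
    _ = Tᴴ * ((T⁻¹)ᴴ * X * T⁻¹) * T := by simp only [Matrix.mul_assoc]
    _ = 0 := by rw [h4]; simp

/-- The equation is invariant under conjugate transposition, so Pᴴ - P solves the homogeneous one.
-/
theorem isHermitian_of_lyapunov [Fintype m] (hT : IsUnit T.det) (hd : T * S * T⁻¹ = diagonal σ)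
    (hσ : ∀ k, 0 < (σ k).re) (hP : Sᴴ * P + P * S - Rᴴ * R = 0) : P.IsHermitian := by
  have h1 : Sᴴ * Pᴴ + Pᴴ * S - Rᴴ * R = 0 := by
    have := congrArg Matrix.conjTranspose hP
    simp only [Matrix.conjTranspose_sub, Matrix.conjTranspose_add, Matrix.conjTranspose_mul,
      Matrix.conjTranspose_conjTranspose, Matrix.conjTranspose_zero] at this
    rw [← this, add_comm (Pᴴ * S)]
  have h2 : Sᴴ * (Pᴴ - P) + (Pᴴ - P) * S = 0 := by
    calc _ = (Sᴴ * Pᴴ + Pᴴ * S - Rᴴ * R) - (Sᴴ * P + P * S - Rᴴ * R) := by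
          simp only [Matrix.mul_sub, Matrix.sub_mul]; abel
      _ = 0 := by rw [h1, hP, sub_zero]
  exact sub_eq_zero.1 (eq_zero_of_lyapunov hT hd hσ h2)

/-- An eigenvector of `S` is not in the kernel of `R` (observability). -/
theorem mulVec_ne_zero_of_eigenvector (hT : IsUnit T.det) (hd : T * S * T⁻¹ = diagonal σ)
    (hinj : Function.Injective σ) (hR : ∀ k, (R * T⁻¹).col k ≠ 0) {x : q → ℂ} {μ : ℂ}
    (hx : x ≠ 0) (hSx : S *ᵥ x = μ • x) : R *ᵥ x ≠ 0 := by
  set y := T *ᵥ x with hy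
  have hxy : x = T⁻¹ *ᵥ y := by
    rw [hy, Matrix.mulVec_mulVec, Matrix.nonsing_inv_mul _ hT, Matrix.one_mulVec]
  have hdy : diagonal σ *ᵥ y = μ • y := by
    rw [← hd, ← Matrix.mulVec_mulVec, ← hxy, ← Matrix.mulVec_mulVec, hSx, Matrix.mulVec_smul]
  have hy0 : y ≠ 0 := fun h => hx (by rw [hxy, h, Matrix.mulVec_zero])
  obtain ⟨k, hk⟩ := Function.ne_iff.1 hy0
  have hk : y k ≠ 0 := hk
  have hcomp : ∀ l, σ l * y l = μ * y l := fun l => by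
    simpa [Matrix.mulVec_diagonal] using congrFun hdy l
  have hμ : σ k = μ := mul_right_cancel₀ hk (hcomp k)
  -- Distinct eigenvalues make y = T x supported at k alone, so R x is `y k` times the k-th column
  -- of R T⁻¹.
  have hl : ∀ l, l ≠ k → y l = 0 := fun l hlk => by
    by_contra h
    exact hlk (hinj ((mul_right_cancel₀ h (hcomp l)).trans hμ.symm))
  intro h0
  rw [hxy, Matrix.mulVec_mulVec] at h0
  refine hR k (funext fun i => ?_)
  have h1 := congrFun h0 i
  rw [Matrix.mulVec, dotProduct, Finset.sum_eq_single k (fun l _ h => by rw [hl l h, mul_zero])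
    (fun h => absurd (Finset.mem_univ k) h)] at h1
  simpa [hk] using h1

/-- The solution of the Lyapunov equation of an observable pair is nonsingular. -/
theorem isUnit_det_of_lyapunov [Fintype m] (hT : IsUnit T.det) (hd : T * S * T⁻¹ = diagonal σ)
    (hinj : Function.Injective σ) (hR : ∀ k, (R * T⁻¹).col k ≠ 0)
    (hσ : ∀ k, 0 < (σ k).re) (hP : Sᴴ * P + P * S - Rᴴ * R = 0) : IsUnit P.det := by
  have hherm := isHermitian_of_lyapunov hT hd hσ hP
  have hLy : ∀ x : q → ℂ, P *ᵥ x = 0 → P *ᵥ (S *ᵥ x) = Rᴴ *ᵥ (R *ᵥ x) := fun x hx => by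
    have h1 := congrArg (fun M : Matrix q q ℂ => M *ᵥ x) hP
    simp only [Matrix.sub_mulVec, Matrix.add_mulVec, ← Matrix.mulVec_mulVec, hx,
      Matrix.mulVec_zero, zero_add, Matrix.zero_mulVec] at h1
    exact sub_eq_zero.1 h1
  -- For x in ker P, pairing P S x = R* R x with x gives ‖R x‖² = 0, since x* P = 0 for Hermitian P.
  have hRx : ∀ x : q → ℂ, P *ᵥ x = 0 → R *ᵥ x = 0 := fun x hx => by
    have h1 : star x ⬝ᵥ (P *ᵥ (S *ᵥ x)) = 0 := by
      rw [Matrix.dotProduct_mulVec]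
      have : star x ᵥ* P = 0 := by
        rw [← hherm.eq, ← Matrix.star_mulVec, hx, star_zero]
      rw [this, zero_dotProduct]
    rw [hLy x hx, Matrix.dotProduct_mulVec, ← Matrix.star_mulVec] at h1
    open ComplexOrder in exact dotProduct_star_self_eq_zero.1 h1
  rw [isUnit_iff_ne_zero]
  intro hdet
  obtain ⟨v, hv0, hv⟩ := Matrix.exists_mulVec_eq_zero_iff.2 hdet
  set U : Submodule ℂ (q → ℂ) := LinearMap.ker P.mulVecLin with hU
  have hmem : ∀ x, x ∈ U ↔ P *ᵥ x = 0 := fun x => by simp [hU]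
  -- Now P S x = R* R x = 0, so ker P is S-invariant. If nonzero it contains an eigenvector of S
  -- killed by R, which is impossible.
  have hinv : ∀ x ∈ U, S.mulVecLin x ∈ U := fun x hx => by
    rw [hmem] at hx ⊢
    rw [Matrix.mulVecLin_apply, hLy x hx, hRx x hx, Matrix.mulVec_zero]
  have : Nontrivial U := ⟨⟨⟨v, (hmem v).2 hv⟩, 0, fun h => hv0 (congrArg Subtype.val h)⟩⟩
  obtain ⟨μ, hμ⟩ := Module.End.exists_eigenvalue (S.mulVecLin.restrict hinv)
  obtain ⟨x, hx⟩ := hμ.exists_hasEigenvector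
  have hSx : S *ᵥ (x : q → ℂ) = μ • (x : q → ℂ) := by
    simpa using congrArg Subtype.val hx.apply_eq_smul
  exact mulVec_ne_zero_of_eigenvector hT hd hinj hR (fun h => hx.2 (Subtype.ext h)) hSx
    (hRx _ ((hmem _).1 x.2))

/-! ### The resolvent of -S* and its poles -/

theorem add_star_ne_zero {q : Type*} {σ : q → ℂ} (hσ : ∀ k, 0 < (σ k).re) {s : ℂ} (hs : 0 ≤ s.re) (k : q) :
    s + star (σ k) ≠ 0 := fun h => by
  have h' := congrArg Complex.re h
  have := hσ k
  simp at h'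
  linarith

theorem smul_one_sub_neg_eq (hT : IsUnit T.det) (hd : T * S * T⁻¹ = diagonal σ) (s : ℂ) :
    s • (1 : Matrix q q ℂ) - -Sᴴ = Tᴴ * diagonal (fun k => s + star (σ k)) * (T⁻¹)ᴴ := by
  have h5 : (T)ᴴ * (T⁻¹)ᴴ = 1 := by
    rw [← Matrix.conjTranspose_mul, Matrix.nonsing_inv_mul _ hT, Matrix.conjTranspose_one]
  have hS : S = T⁻¹ * diagonal σ * T := by
    rw [← mul_inv_eq_inv_mul_diagonal hT hd, Matrix.mul_assoc, Matrix.nonsing_inv_mul _ hT,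
      Matrix.mul_one]
  have hdiag : diagonal (fun k => s + star (σ k)) = s • (1 : Matrix q q ℂ) + diagonal (star σ) := by
    rw [Matrix.smul_one_eq_diagonal, Matrix.diagonal_add]; rfl
  rw [hdiag, Matrix.mul_add, Matrix.add_mul, Matrix.mul_smul, Matrix.smul_mul, Matrix.mul_one, h5,
    sub_neg_eq_add]
  congr 1
  conv_lhs => rw [hS]
  rw [Matrix.conjTranspose_mul, Matrix.conjTranspose_mul, Matrix.diagonal_conjTranspose,
    Matrix.mul_assoc]

theorem det_smul_one_sub_neg (hT : IsUnit T.det) (hd : T * S * T⁻¹ = diagonal σ) (s : ℂ) :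
    (s • (1 : Matrix q q ℂ) - -Sᴴ).det = ∏ k, (s + star (σ k)) := by
  have h5 : (T)ᴴ * (T⁻¹)ᴴ = 1 := by
    rw [← Matrix.conjTranspose_mul, Matrix.nonsing_inv_mul _ hT, Matrix.conjTranspose_one]
  have h6 := congrArg Matrix.det h5
  rw [Matrix.det_mul, Matrix.det_one] at h6
  rw [smul_one_sub_neg_eq hT hd, Matrix.det_mul, Matrix.det_mul, Matrix.det_diagonal]
  linear_combination (∏ k, (s + star (σ k))) * h6

theorem inv_smul_one_sub_neg (hT : IsUnit T.det) (hd : T * S * T⁻¹ = diagonal σ) {s : ℂ}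
    (hs : ∀ k, s + star (σ k) ≠ 0) :
    (s • (1 : Matrix q q ℂ) - -Sᴴ)⁻¹ =
      Tᴴ * diagonal (fun k => (s + star (σ k))⁻¹) * (T⁻¹)ᴴ := by
  have h5 : (T)ᴴ * (T⁻¹)ᴴ = 1 := by
    rw [← Matrix.conjTranspose_mul, Matrix.nonsing_inv_mul _ hT, Matrix.conjTranspose_one]
  have h6 : (T⁻¹)ᴴ * Tᴴ = 1 := by
    rw [← Matrix.conjTranspose_mul, Matrix.mul_nonsing_inv _ hT, Matrix.conjTranspose_one]
  refine Matrix.inv_eq_right_inv ?_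
  rw [smul_one_sub_neg_eq hT hd]
  calc _ = Tᴴ * diagonal (fun k => s + star (σ k)) * ((T⁻¹)ᴴ * Tᴴ) *
        diagonal (fun k => (s + star (σ k))⁻¹) * (T⁻¹)ᴴ := by simp only [Matrix.mul_assoc]
    _ = Tᴴ * (diagonal (fun k => s + star (σ k)) *
        diagonal (fun k => (s + star (σ k))⁻¹)) * (T⁻¹)ᴴ := by
          rw [h6, Matrix.mul_one]; simp only [Matrix.mul_assoc]
    _ = 1 := by
          rw [Matrix.diagonal_mul_diagonal]
          simp only [mul_inv_cancel₀ (hs _)]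
          rw [Matrix.diagonal_one, Matrix.mul_one, h5]

theorem isAsymptoticallyStable_one_neg (hT : IsUnit T.det) (hd : T * S * T⁻¹ = diagonal σ)
    (hσ : ∀ k, 0 < (σ k).re) : IsAsymptoticallyStable 1 (-Sᴴ) := by
  refine ⟨⟨0, ?_⟩, fun z hz => ?_⟩
  · rw [det_smul_one_sub_neg hT hd, Finset.prod_ne_zero_iff]
    exact fun k _ => add_star_ne_zero hσ le_rfl k
  · by_contra h
    have hz : (z • (1 : Matrix q q ℂ) - -Sᴴ).det = 0 := hz
    rw [det_smul_one_sub_neg hT hd, Finset.prod_eq_zero_iff] at hz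
    obtain ⟨k, -, hk⟩ := hz
    exact add_star_ne_zero hσ (not_lt.1 h) k hk

/-! ### Orthogonality and tangential interpolation -/

/-- Pole-residue form of the functions in `𝒢(-S^*, R^*)`. -/
theorem transferFunction_eq_sum (hT : IsUnit T.det) (hd : T * S * T⁻¹ = diagonal σ)
    (D : Matrix p q ℂ) {s : ℂ} (hs : ∀ k, s + star (σ k) ≠ 0) (i : p) (j : m) :
    transferFunction 1 (-Sᴴ) Rᴴ D s i j =
      ∑ k, (D * Tᴴ) i k * (s + star (σ k))⁻¹ * star ((R * T⁻¹) j k) := by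
  have h1 : transferFunction 1 (-Sᴴ) Rᴴ D s =
      (D * Tᴴ) * diagonal (fun k => (s + star (σ k))⁻¹) * (R * T⁻¹)ᴴ := by
    rw [transferFunction, inv_smul_one_sub_neg hT hd hs, Matrix.conjTranspose_mul]
    simp only [Matrix.mul_assoc]
  rw [h1, Matrix.mul_apply]
  simp only [Matrix.mul_diagonal, Matrix.conjTranspose_apply]

theorem isStrictlyProper_transferFunction [Fintype m] [Fintype p] (hT : IsUnit T.det) (hd : T * S * T⁻¹ = diagonal σ)
    (D : Matrix p q ℂ) : IsStrictlyProper (transferFunction 1 (-Sᴴ) Rᴴ D) := by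
  refine tendsto_pi_nhds.2 fun i => tendsto_pi_nhds.2 fun j => ?_
  have hev : ∀ᶠ s in cobounded ℂ, ∀ k, s + star (σ k) ≠ 0 := by
    refine eventually_all.2 fun k => ?_
    filter_upwards [eventually_ne_cobounded (-star (σ k))] with s hs h
    exact hs (eq_neg_of_add_eq_zero_left h)
  have hlim : Tendsto (fun s : ℂ => ∑ k, (D * Tᴴ) i k * (s + star (σ k))⁻¹ * star ((R * T⁻¹) j k))
      (cobounded ℂ) (𝓝 (∑ k, (D * Tᴴ) i k * 0 * star ((R * T⁻¹) j k))) := by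
    refine tendsto_finsetSum _ fun k _ => ((Tendsto.const_mul _ ?_).mul_const _)
    exact tendsto_inv₀_cobounded.comp (tendsto_add_const_cobounded _)
  simp only [mul_zero, zero_mul, Finset.sum_const_zero] at hlim
  refine hlim.congr' ?_
  filter_upwards [hev] with s hs
  rw [transferFunction_eq_sum hT hd D hs]

/-- A decaying function which vanishes at the interpolation points along the tangential
directions is orthogonal to `𝒢(-S^*, R^*)`. -/
theorem integral_inner_eq_zero [Fintype m] [Fintype p] (hT : IsUnit T.det) (hd : T * S * T⁻¹ = diagonal σ)
    (hσ : ∀ k, 0 < (σ k).re) {F : ℂ → Matrix p m ℂ} (hF : ∀ i j, IsDecaying (fun s => F s i j))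
    (hint : ∀ k, F (σ k) *ᵥ (R * T⁻¹).col k = 0) (D : Matrix p q ℂ) :
    ∫ ω : ℝ, ∑ i, ∑ j, F (I * ω) i j *
      star (transferFunction 1 (-Sᴴ) Rᴴ D (I * ω) i j) = 0 := by
  set f : p → q → ℂ → ℂ := fun i k s => ∑ j, F s i j * (R * T⁻¹) j k with hf
  have hfd : ∀ i k, IsDecaying (f i k) := fun i k =>
    IsDecaying.sum _ fun j => (hF i j).mul_const _
  have hf0 : ∀ i k, f i k (σ k) = 0 := fun i k => congrFun (hint k) i
  have hstar : ∀ (ω : ℝ) k, star (I * (ω : ℂ) + star (σ k)) = σ k - I * ω := fun ω k => by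
    simp
    ring
  have heq : ∀ ω : ℝ, ∑ i, ∑ j, F (I * ω) i j *
      star (transferFunction 1 (-Sᴴ) Rᴴ D (I * ω) i j) =
      ∑ i, ∑ k, star ((D * Tᴴ) i k) * (f i k (I * ω) * (σ k - I * ω)⁻¹) := fun ω => by
    refine Finset.sum_congr rfl fun i _ => ?_
    simp only [transferFunction_eq_sum hT hd D (add_star_ne_zero hσ (s := I * ω) (by simp)),
      star_sum, star_mul', star_star, star_inv₀, hstar, hf, Finset.mul_sum, Finset.sum_mul]
    rw [Finset.sum_comm]
    refine Finset.sum_congr rfl fun k _ => Finset.sum_congr rfl fun j _ => ?_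
    ring
  have hi : ∀ i k, Integrable (fun ω : ℝ => f i k (I * ω) * (σ k - I * ω)⁻¹) := fun i k => by
    have := (hfd i k).integrable_mul_conj
      (isDecaying_inv_add (a := star (σ k)) (by simpa using hσ k))
    simpa only [star_inv₀, hstar] using this
  simp only [heq]
  rw [integral_finsetSum _ fun i _ => integrable_finsetSum _ fun k _ => (hi i k).const_mul _]
  refine Finset.sum_eq_zero fun i _ => ?_
  rw [integral_finsetSum _ fun k _ => (hi i k).const_mul _]
  refine Finset.sum_eq_zero fun k _ => ?_
  rw [integral_const_mul, (hfd i k).integral_eq_zero (hσ k) (hf0 i k), mul_zero]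

/-- Interpolation property of the elements of `𝒢(-S^*, R^*)`. -/
theorem transferFunction_mulVec_direction [Fintype m] (hT : IsUnit T.det) (hd : T * S * T⁻¹ = diagonal σ)
    (hσ : ∀ k, 0 < (σ k).re) (hP : Sᴴ * P + P * S - Rᴴ * R = 0) (D : Matrix p q ℂ) (k : q) :
    transferFunction 1 (-Sᴴ) Rᴴ D (σ k) *ᵥ (R * T⁻¹).col k = D *ᵥ (P *ᵥ T⁻¹.col k) := by
  have hdet := det_ne_zero_of_nonneg_re (isAsymptoticallyStable_one_neg hT hd hσ) (hσ k).le
  have hcol : (R * T⁻¹).col k = R *ᵥ T⁻¹.col k := by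
    ext i; simp [Matrix.mul_apply, Matrix.mulVec, dotProduct]
  -- The Lyapunov equation at t_k reads R* R t_k = (σ_k + S*) P t_k, so the resolvent at σ_k
  -- cancels.
  have h1 : Rᴴ *ᵥ (R *ᵥ T⁻¹.col k) = (σ k • (1 : Matrix q q ℂ) - -Sᴴ) *ᵥ (P *ᵥ T⁻¹.col k) := by
    have h2 := congrArg (fun M : Matrix q q ℂ => M *ᵥ T⁻¹.col k) hP
    simp only [Matrix.sub_mulVec, Matrix.add_mulVec, ← Matrix.mulVec_mulVec,
      Matrix.zero_mulVec, mulVec_eigenvector hT hd, Matrix.mulVec_smul] at h2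
    rw [← sub_eq_zero.1 h2, Matrix.sub_mulVec, Matrix.smul_mulVec, Matrix.one_mulVec,
      Matrix.neg_mulVec, sub_neg_eq_add, add_comm]
  rw [hcol, transferFunction, ← Matrix.mulVec_mulVec, h1, ← Matrix.mulVec_mulVec,
    Matrix.mulVec_mulVec _ (_⁻¹), Matrix.nonsing_inv_mul _ (isUnit_iff_ne_zero.2 hdet),
    Matrix.one_mulVec]

/-- The original model maps the tangential directions to the columns of `-C V T⁻¹`. -/
theorem transferFunction_mulVec_of_sylvester [Fintype m] {n : Type*} [Fintype n] [DecidableEq n]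
    {E A : Matrix n n ℂ} {B : Matrix n m ℂ} (C : Matrix p n ℂ) {V : Matrix n q ℂ}
    (hT : IsUnit T.det) (hd : T * S * T⁻¹ = diagonal σ)
    (hV : A * V - E * V * S - B * R = 0) {k : q} (hk : (σ k • E - A).det ≠ 0) :
    transferFunction E A B C (σ k) *ᵥ (R * T⁻¹).col k = -((C * V) *ᵥ T⁻¹.col k) := by
  have hcol : (R * T⁻¹).col k = R *ᵥ T⁻¹.col k := by
    ext i; simp [Matrix.mul_apply, Matrix.mulVec, dotProduct]
  -- Likewise the Sylvester equation at t_k reads B R t_k = -(σ_k E - A) V t_k.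
  have h1 : B *ᵥ (R *ᵥ T⁻¹.col k) = (σ k • E - A) *ᵥ -(V *ᵥ T⁻¹.col k) := by
    have h2 := congrArg (fun M : Matrix n q ℂ => M *ᵥ T⁻¹.col k) hV
    simp only [Matrix.sub_mulVec, ← Matrix.mulVec_mulVec,
      Matrix.zero_mulVec, mulVec_eigenvector hT hd, Matrix.mulVec_smul] at h2
    rw [← sub_eq_zero.1 h2, Matrix.sub_mulVec, Matrix.smul_mulVec, Matrix.mulVec_neg,
      Matrix.mulVec_neg, smul_neg]
    abel
  rw [hcol, transferFunction, ← Matrix.mulVec_mulVec, h1, ← Matrix.mulVec_mulVec,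
    Matrix.mulVec_mulVec _ (_⁻¹), Matrix.nonsing_inv_mul _ (isUnit_iff_ne_zero.2 hk),
    Matrix.one_mulVec, Matrix.mulVec_neg, Matrix.mulVec_mulVec]

/-! ### The reduced model -/

/-- The reduced model is an element of `𝒢(-S^*, R^*)`. -/
theorem transferFunction_reduced (Y : Matrix p q ℂ) :
    transferFunction P (-Sᴴ * P) (-Rᴴ) Y = transferFunction 1 (-Sᴴ) Rᴴ (-(Y * P⁻¹)) := by
  funext s
  have h1 : s • P - -Sᴴ * P = (s • (1 : Matrix q q ℂ) - -Sᴴ) * P := by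
    rw [Matrix.sub_mul, Matrix.smul_mul, Matrix.one_mul]
  -- Reversal of products holds for the total inverse, so neither P nor the pencil need be
  -- invertible here.
  rw [transferFunction, transferFunction, h1, Matrix.mul_inv_rev]
  simp only [Matrix.mul_neg, Matrix.neg_mul, Matrix.mul_assoc]

theorem isAsymptoticallyStable_reduced (hP : IsUnit P.det)
    (h : IsAsymptoticallyStable 1 (-Sᴴ)) : IsAsymptoticallyStable P (-Sᴴ * P) := by
  have h1 : ∀ s : ℂ, (s • P - -Sᴴ * P).det = (s • (1 : Matrix q q ℂ) - -Sᴴ).det * P.det :=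
    fun s => by rw [← Matrix.det_mul, Matrix.sub_mul, Matrix.smul_mul, Matrix.one_mul]
  obtain ⟨⟨z, hz⟩, h2⟩ := h
  refine ⟨⟨z, ?_⟩, fun s hs => h2 s ?_⟩
  · rw [h1]; exact mul_ne_zero hz hP.ne_zero
  · have hs : (s • P - -Sᴴ * P).det = 0 := hs
    rw [h1] at hs
    exact (mul_eq_zero.1 hs).resolve_right hP.ne_zero

/-- An element of `𝒢(-S^*, R^*)` which vanishes in the right half-plane has zero output matrix. -/
theorem output_eq_zero [Fintype m] (hT : IsUnit T.det) (hd : T * S * T⁻¹ = diagonal σ)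
    (hσ : ∀ k, 0 < (σ k).re) (hP : Sᴴ * P + P * S - Rᴴ * R = 0) (hPdet : IsUnit P.det)
    {D : Matrix p q ℂ} (h0 : ∀ s : ℂ, 0 ≤ s.re → transferFunction 1 (-Sᴴ) Rᴴ D s = 0) :
    D = 0 := by
  -- The values at σ_k along r_k are exactly the columns of D P T⁻¹.
  have h1 : D * P * T⁻¹ = 0 := by
    ext i k
    have h2 := transferFunction_mulVec_direction hT hd hσ hP D k
    rw [h0 _ (hσ k).le, Matrix.zero_mulVec, Matrix.mulVec_mulVec] at h2
    have h3 := congrFun h2 i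
    simpa [Matrix.mul_apply, Matrix.mulVec, dotProduct] using h3.symm
  calc D = D * P * (T⁻¹ * T) * P⁻¹ := by
        rw [Matrix.nonsing_inv_mul _ hT, Matrix.mul_one, Matrix.mul_assoc,
          Matrix.mul_nonsing_inv _ hPdet, Matrix.mul_one]
    _ = D * P * T⁻¹ * T * P⁻¹ := by simp only [Matrix.mul_assoc]
    _ = 0 := by rw [h1]; simp

theorem transferFunction_sub (D D' : Matrix p q ℂ) :
    transferFunction 1 (-Sᴴ) Rᴴ D - transferFunction 1 (-Sᴴ) Rᴴ D' =
      transferFunction 1 (-Sᴴ) Rᴴ (D - D') := by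
  funext s
  simp only [Pi.sub_apply, transferFunction, Matrix.sub_mul]

end Diag

end DAE

/-! ### Pseudo-optimality and uniqueness -/

theorem mainTheorem3 {n m p q : ℕ}
    (E A : Matrix (Fin n) (Fin n) ℂ) (B : Matrix (Fin n) (Fin m) ℂ) (C : Matrix (Fin p) (Fin n) ℂ)
    (hstable : DAE.IsAsymptoticallyStable E A)
    (hproper : DAE.IsStrictlyProper (DAE.transferFunction E A B C))
    (S : Matrix (Fin q) (Fin q) ℂ) (R : Matrix (Fin m) (Fin q) ℂ)
    (hSR : DAE.IsRightTangentialData E A S R)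
    (hS : ∀ z ∈ spectrum ℂ S, 0 < z.re)
    (V : Matrix (Fin n) (Fin q) ℂ) (hV : A * V - E * V * S - B * R = 0)
    (P : Matrix (Fin q) (Fin q) ℂ) (hP : Sᴴ * P + P * S - Rᴴ * R = 0) :
    -- all transfer functions involved lie in `H₂`, so that the `H₂` errors are finite
    DAE.MemH2 (DAE.transferFunction E A B C) ∧
    (∀ GM ∈ DAE.transferSubspace (Fin p) (-Sᴴ) Rᴴ, DAE.MemH2 GM) ∧
    -- the reduced model is an ODE, and it is asymptotically stable
    IsUnit P.det ∧
    DAE.IsAsymptoticallyStable P (-Sᴴ * P) ∧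
    -- it is pseudo-optimal, and its transfer function is the only pseudo-optimal one
    DAE.IsH2PseudoOptimal (DAE.transferFunction E A B C) (-Sᴴ) Rᴴ
      (DAE.transferFunction P (-Sᴴ * P) (-Rᴴ) (C * V)) ∧
    ∀ Gr : ℂ → Matrix (Fin p) (Fin m) ℂ,
      DAE.IsH2PseudoOptimal (DAE.transferFunction E A B C) (-Sᴴ) Rᴴ Gr →
        Gr = DAE.transferFunction P (-Sᴴ * P) (-Rᴴ) (C * V) := by
  obtain ⟨T, σ, hT, hinj, hd, hσE, hR⟩ := hSR
  have hσ := DAE.re_pos_of_spectrum hT hd hS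
  have hPdet := DAE.isUnit_det_of_lyapunov hT hd hinj hR hσ hP
  have hst := DAE.isAsymptoticallyStable_one_neg hT hd hσ
  have hsp : ∀ D : Matrix (Fin p) (Fin q) ℂ, DAE.IsStrictlyProper
      (DAE.transferFunction 1 (-Sᴴ) Rᴴ D) :=
    DAE.isStrictlyProper_transferFunction hT hd
  rw [DAE.transferFunction_reduced]
  set G := DAE.transferFunction E A B C with hG
  -- The solution of D P = -C V, the interpolation condition on the output matrix.
  set D₀ : Matrix (Fin p) (Fin q) ℂ := -(C * V * P⁻¹) with hD₀
  set K : Matrix (Fin p) (Fin q) ℂ → ℂ → Matrix (Fin p) (Fin m) ℂ :=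
    fun D => DAE.transferFunction 1 (-Sᴴ) Rᴴ D with hK
  have hKd : ∀ D i j, DAE.IsDecaying (fun s => K D s i j) := fun D =>
    DAE.isDecaying_transferFunction hst (hsp D)
  have hFd : ∀ i j, DAE.IsDecaying (fun s => (G - K D₀) s i j) := fun i j =>
    (DAE.isDecaying_transferFunction hstable hproper i j).sub (hKd D₀ i j)
  have hzero : ∀ k, (G - K D₀) (σ k) *ᵥ (R * T⁻¹).col k = 0 := fun k => by
    rw [Pi.sub_apply, Matrix.sub_mulVec, hG,
      DAE.transferFunction_mulVec_of_sylvester C hT hd hV (hσE k), hK,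
      DAE.transferFunction_mulVec_direction hT hd hσ hP, Matrix.mulVec_mulVec, hD₀,
      Matrix.neg_mul, Matrix.mul_assoc (C * V), Matrix.nonsing_inv_mul _ hPdet, Matrix.mul_one,
      Matrix.neg_mulVec, sub_self]
  -- Split G - K D into the error G - K D₀, orthogonal to 𝒢, and K (D₀ - D), which lies in 𝒢.
  have hpyth : ∀ D, ∫ ω : ℝ, DAE.frobeniusSq ((G - K D) (Complex.I * ω)) =
      (∫ ω : ℝ, DAE.frobeniusSq ((G - K D₀) (Complex.I * ω))) +
        ∫ ω : ℝ, DAE.frobeniusSq (K (D₀ - D) (Complex.I * ω)) := fun D => by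
    rw [← DAE.integral_frobeniusSq_add hFd (hKd (D₀ - D))
      (DAE.integral_inner_eq_zero hT hd hσ hFd hzero (D₀ - D))]
    have : G - K D₀ + K (D₀ - D) = G - K D := by
      simp only [hK, ← DAE.transferFunction_sub]
      abel
    rw [this]
  have hnn : ∀ F : ℂ → Matrix (Fin p) (Fin m) ℂ,
      0 ≤ ∫ ω : ℝ, DAE.frobeniusSq (F (Complex.I * ω)) := fun F =>
    integral_nonneg fun ω => DAE.frobeniusSq_nonneg _
  refine ⟨DAE.memH2_transferFunction hstable hproper, ?_, hPdet,
    DAE.isAsymptoticallyStable_reduced hPdet hst, ⟨⟨D₀, rfl⟩, ?_⟩, ?_⟩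
  · rintro _ ⟨D, rfl⟩
    exact DAE.memH2_transferFunction hst (hsp D)
  · rintro _ ⟨D, rfl⟩
    refine Real.sqrt_le_sqrt (mul_le_mul_of_nonneg_left ?_ (by positivity))
    have := hpyth D
    have := hnn (K (D₀ - D))
    change _ ≤ ∫ ω : ℝ, DAE.frobeniusSq ((G - K D) (Complex.I * ω))
    linarith
  · rintro _ ⟨⟨D, rfl⟩, hle⟩
    have h1 := hle _ ⟨D₀, rfl⟩
    unfold DAE.h2Norm at h1
    rw [Real.sqrt_le_sqrt_iff (mul_nonneg (by positivity) (hnn _)),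
      mul_le_mul_iff_of_pos_left (by positivity)] at h1
    have h2 := hpyth D
    have h3 := hnn (K (D₀ - D))
    have h4 : ∫ ω : ℝ, DAE.frobeniusSq (K (D₀ - D) (Complex.I * ω)) = 0 := by
      have h1 : ∫ ω : ℝ, DAE.frobeniusSq ((G - K D) (Complex.I * ω)) ≤
        ∫ ω : ℝ, DAE.frobeniusSq ((G - K D₀) (Complex.I * ω)) := h1
      linarith
    have h5 := DAE.output_eq_zero hT hd hσ hP hPdet (D := D₀ - D)
      fun s hs => DAE.eq_zero_of_integral_frobeniusSq_eq_zero (hKd (D₀ - D)) h4 hs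
    -- Equal output matrices give equal functions on all of ℂ, including the default values at the
    -- poles.
    rw [sub_eq_zero.1 h5]
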